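/- For every $n$ there is a constant $C(n)>0$, depending only on $n$, with the following property. Let $\tau\le 0$ and let $u\in C^2(\mathbb{R}^n)$ satisfy $u\ge 1$ and $\Delta u=u^{\tau}$ on all of $\mathbb{R}^n$. Then, for all $x\in\mathbb{R}^n$, $$u(x)\le C(n)\,\bigl(|x|^2+u(0)\bigr)\qquad\text{and}\qquad |\nabla u(x)|\le C(n)\,\bigl(|x|+u(0)\bigr).$$ In particular, if $u(0)=1$, then $u(x)\le C(n)(|x|^2+1)$ and $|\nabla u(x)|\le C(n)(|x|+1)$; in general $u$ grows at most quadratically and $\nabla u$ at most linearly. -/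

import Mathlib

/-!
Write `f = Δ u`; the hypotheses give `u ≥ 1` and `0 ≤ f ≤ 1`, and nothing else about the equation
is needed. Averages of `u` over balls are taken with the polynomial weights
`quadBump k y = (1 - ‖y‖²)₊ ^ k`, which play the role of the indicator of the unit ball and satisfy
`∇ (quadBump (k + 1)) = -2 (k + 1) quadBump k · y` for `k ≥ 1`. Differentiating
`t ↦ ∫ u (x + t y) quadBump 3 y` and integrating by parts gives
`∫ u (x + T y) quadBump 3 y - u x ∫ quadBump 3 = T c ∫ f (x + c y) quadBump 4 y / 8` for some
`0 < c < T` (`exists_average_sub_eq_laplacian`), a smooth form of the mean value property.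

*Growth.* With `T = ‖x‖ + 1`, the value `u x` is at most its average over `B(x, T)`, which by
positivity of `u` is controlled by the average over `B(0, 4T)` (`integral_quadBump_le`), and the
latter is at most `u 0` plus a multiple of `T²`.

*Gradient.* The same derivative formula for `∂ₑ u` in place of `u` involves second derivatives
`∂ᵢ ∂ₑ u`; as the weight times `y` is itself a gradient, two integrations by parts turn them into
`f` (`integral_fderiv_fderiv_eq_laplacian`). Thus `∂ₑ u x` differs from its average by `O(T)`,
while a last integration by parts bounds the average by `1 / T` times an average of `u`.
-/

open MeasureTheory Set Metric

section

variable {E : Type*} [NormedAddCommGroup E]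

/-! ### Polynomial bump functions -/

/-- The weight `(1 - ‖y‖²)₊ ^ k`, supported in the closed unit ball. -/
noncomputable def quadBump (k : ℕ) (y : E) : ℝ := (max 0 (1 - ‖y‖ ^ 2)) ^ k

lemma quadBump_nonneg (k : ℕ) (y : E) : 0 ≤ quadBump k y := by
  unfold quadBump; positivity

lemma quadBump_le_one (k : ℕ) (y : E) : quadBump k y ≤ 1 :=
  pow_le_one₀ (le_max_left _ _) (max_le zero_le_one (by nlinarith [sq_nonneg ‖y‖]))

lemma quadBump_eq_zero {k : ℕ} (hk : k ≠ 0) {y : E} (hy : 1 ≤ ‖y‖) : quadBump k y = 0 := by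
  unfold quadBump
  rw [max_eq_left (by nlinarith), zero_pow hk]

lemma continuous_quadBump (k : ℕ) : Continuous (quadBump k : E → ℝ) := by
  unfold quadBump; fun_prop

lemma hasDerivAt_posPart_pow (k : ℕ) (s : ℝ) :
    HasDerivAt (fun s : ℝ ↦ (max 0 s) ^ (k + 2)) ((k + 2) * (max 0 s) ^ (k + 1)) s := by
  rcases lt_trichotomy s 0 with h | h | h
  · rw [max_eq_left h.le, zero_pow (by simp), mul_zero]
    refine (hasDerivAt_const s (0 : ℝ)).congr_of_eventuallyEq ?_
    filter_upwards [Iio_mem_nhds h] with r hr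
    rw [max_eq_left (le_of_lt hr), zero_pow (by simp)]
  · subst h
    simp only [max_self, ne_eq, Nat.add_eq_zero_iff, one_ne_zero, and_false, not_false_eq_true,
      zero_pow, mul_zero]
    rw [hasDerivAt_iff_isLittleO]
    simp only [max_self, ne_eq, Nat.add_eq_zero_iff, OfNat.ofNat_ne_zero, and_false,
      not_false_eq_true, zero_pow, sub_zero, smul_zero]
    refine Asymptotics.IsBigO.trans_isLittleO (g := fun r : ℝ ↦ r ^ (k + 2)) ?_
      (Asymptotics.isLittleO_pow_id (by omega))
    refine Asymptotics.IsBigO.of_bound 1 (Filter.Eventually.of_forall fun r ↦ ?_)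
    rw [one_mul, norm_pow, norm_pow]
    gcongr
    rw [Real.norm_eq_abs, Real.norm_eq_abs, abs_of_nonneg (le_max_left _ _)]
    exact max_le (abs_nonneg _) (le_abs_self _)
  · rw [max_eq_right h.le]
    have := hasDerivAt_pow (k + 2) s
    push_cast at this
    refine this.congr_of_eventuallyEq ?_
    filter_upwards [Ioi_mem_nhds h] with r hr
    rw [max_eq_right (le_of_lt hr)]

variable [InnerProductSpace ℝ E]

lemma hasCompactSupport_quadBump [FiniteDimensional ℝ E] {k : ℕ} (hk : k ≠ 0) :
    HasCompactSupport (quadBump k : E → ℝ) := by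
  have := FiniteDimensional.proper ℝ E
  refine HasCompactSupport.intro (isCompact_closedBall (0 : E) 1) fun y hy ↦ ?_
  refine quadBump_eq_zero hk ?_
  simp at hy
  exact hy.le

lemma hasFDerivAt_quadBump (k : ℕ) (y : E) :
    HasFDerivAt (quadBump (k + 2) : E → ℝ)
      ((-2 * (k + 2) * quadBump (k + 1) y) • innerSL ℝ y) y := by
  have h1 : HasFDerivAt (fun y : E ↦ 1 - ‖y‖ ^ 2) (-((2 : ℝ) • innerSL ℝ y)) y := by
    simpa [two_smul] using ((hasStrictFDerivAt_norm_sq y).hasFDerivAt).const_sub 1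
  refine ((hasDerivAt_posPart_pow k _).comp_hasFDerivAt y h1).congr_fderiv ?_
  ext e
  simp [quadBump]
  ring

lemma contDiff_quadBump (k : ℕ) : ContDiff ℝ 1 (quadBump (k + 2) : E → ℝ) := by
  refine contDiff_one_iff_hasFDerivAt.2 ⟨_, ?_, hasFDerivAt_quadBump k⟩
  have := continuous_quadBump (E := E) (k + 1)
  fun_prop

lemma fderiv_quadBump (k : ℕ) (y e : E) :
    fderiv ℝ (quadBump (k + 2)) y e = -2 * (k + 2) * quadBump (k + 1) y * inner ℝ y e := by
  rw [(hasFDerivAt_quadBump k y).fderiv]; simp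

/-! ### Second derivatives and the Laplacian -/

lemma contDiff_fderiv_apply {u : E → ℝ} (hu : ContDiff ℝ 2 u) (e : E) :
    ContDiff ℝ 1 (fun z ↦ fderiv ℝ u z e) :=
  (hu.fderiv_right (m := 1) (by norm_num)).clm_apply contDiff_const

lemma fderiv_fderiv_apply {u : E → ℝ} (hu : ContDiff ℝ 2 u) (e z a : E) :
    fderiv ℝ (fun z ↦ fderiv ℝ u z e) z a = fderiv ℝ (fderiv ℝ u) z a e := by
  rw [fderiv_clm_apply
    ((hu.fderiv_right (m := 1) (by norm_num)).differentiable (by simp) z) (by fun_prop)]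
  simp

lemma fderiv_fderiv_comm {u : E → ℝ} (hu : ContDiff ℝ 2 u) (z a b : E) :
    fderiv ℝ (fderiv ℝ u) z a b = fderiv ℝ (fderiv ℝ u) z b a :=
  (hu.contDiffAt.isSymmSndFDerivAt (by simp)).eq a b

variable [FiniteDimensional ℝ E]

lemma laplacian_eq_sum_fderiv (u : E → ℝ) (z : E) :
    Laplacian.laplacian u z = ∑ i, fderiv ℝ (fderiv ℝ u) z (stdOrthonormalBasis ℝ E i)
      (stdOrthonormalBasis ℝ E i) := by
  rw [InnerProductSpace.laplacian_eq_iteratedFDeriv_stdOrthonormalBasis]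
  simp [iteratedFDeriv_two_apply]

lemma map_eq_sum_basis (L : E →L[ℝ] ℝ) (y : E) :
    L y = ∑ i, L (stdOrthonormalBasis ℝ E i) * inner ℝ y (stdOrthonormalBasis ℝ E i) := by
  conv_lhs => rw [← (stdOrthonormalBasis ℝ E).sum_repr' y]
  simp only [map_sum, map_smul, smul_eq_mul, real_inner_comm, mul_comm]

lemma continuous_laplacian {u : E → ℝ} (hu : ContDiff ℝ 2 u) :
    Continuous (Laplacian.laplacian u) := by
  have h : Continuous (fderiv ℝ (fderiv ℝ u)) :=
    (hu.fderiv_right (m := 1) (by norm_num)).continuous_fderiv (by simp)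
  simp only [funext (laplacian_eq_sum_fderiv u)]
  fun_prop

/-! ### Weighted averages and integration by parts -/

variable [MeasurableSpace E] [BorelSpace E] (μ : Measure E) [μ.IsAddHaarMeasure]

omit [InnerProductSpace ℝ E] [FiniteDimensional ℝ E] in
lemma integrable_mul_of_hasCompactSupport {f g : E → ℝ} (hf : Continuous f) (hg : Continuous g)
    (hc : HasCompactSupport g) : Integrable (fun y ↦ f y * g y) μ :=
  (hf.mul hg).integrable_of_hasCompactSupport (hc.mul_left (f := f))

lemma integral_quadBump_pos {k : ℕ} (hk : k ≠ 0) : 0 < ∫ y, quadBump k y ∂μ := by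
  refine (continuous_quadBump k).integral_pos_of_hasCompactSupport_nonneg_nonzero
    (hasCompactSupport_quadBump hk) (quadBump_nonneg k) (x := 0) ?_
  simp [quadBump]

omit [FiniteDimensional ℝ E] in
/-- The mean value theorem for `t ↦ ∫ v (x + t y) φ y`. -/
lemma exists_average_sub_eq {v φ : E → ℝ} (hv : ContDiff ℝ 1 v) (hφ : Continuous φ)
    (hc : HasCompactSupport φ) (x : E) {T : ℝ} (hT : 0 < T) :
    ∃ c ∈ Ioo 0 T, ∫ y, v (x + T • y) * φ y ∂μ - v x * ∫ y, φ y ∂μ =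
      T * ∫ y, fderiv ℝ v (x + c • y) y * φ y ∂μ := by
  have hv' : Continuous (fderiv ℝ v) := hv.continuous_fderiv (by simp)
  have hvc : Continuous v := hv.continuous
  have key : ∀ s : ℝ, HasDerivAt (fun t : ℝ ↦ ∫ y, v (x + t • y) * φ y ∂μ)
      (∫ y, fderiv ℝ v (x + s • y) y * φ y ∂μ) s := by
    intro s
    obtain ⟨M, hM⟩ := ((isCompact_closedBall s 1).prod hc).exists_bound_of_continuousOn
      (f := fun p : ℝ × E ↦ fderiv ℝ v (x + p.1 • p.2) p.2)
      (by fun_prop : Continuous fun p : ℝ × E ↦ fderiv ℝ v (x + p.1 • p.2) p.2).continuousOn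
    refine (hasDerivAt_integral_of_dominated_loc_of_deriv_le (s := ball s 1)
      (F := fun (t : ℝ) y ↦ v (x + t • y) * φ y)
      (F' := fun (t : ℝ) y ↦ fderiv ℝ v (x + t • y) y * φ y)
      (bound := fun y ↦ M * |φ y|) (ball_mem_nhds s one_pos) ?_ ?_ ?_ ?_ ?_ ?_).2
    · exact Filter.Eventually.of_forall fun t ↦ Continuous.aestronglyMeasurable (by fun_prop)
    · exact integrable_mul_of_hasCompactSupport μ (f := fun y ↦ v (x + s • y)) (by fun_prop) hφ hc
    · exact Continuous.aestronglyMeasurable (by fun_prop)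
    · refine Filter.Eventually.of_forall fun y t ht ↦ ?_
      by_cases hy : y ∈ tsupport φ
      · rw [norm_mul, Real.norm_eq_abs (φ y)]
        gcongr
        exact hM (t, y) ⟨ball_subset_closedBall ht, hy⟩
      · simp [image_eq_zero_of_notMem_tsupport hy]
    · exact ((hφ.integrable_of_hasCompactSupport hc).abs).const_mul M
    · refine Filter.Eventually.of_forall fun y t _ ↦ ?_
      have h1 : HasDerivAt (fun t : ℝ ↦ x + t • y) y t := by
        simpa using ((hasDerivAt_id t).smul_const y).const_add x
      exact (((hv.differentiable (by simp) _).hasFDerivAt.comp_hasDerivAt t h1).mul_const (φ y))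
  obtain ⟨c, hc, h⟩ := exists_hasDerivAt_eq_slope _ _ hT
    (fun t _ ↦ (key t).continuousAt.continuousWithinAt) (fun t _ ↦ key t)
  refine ⟨c, hc, ?_⟩
  rw [h]
  simp only [zero_smul, add_zero, sub_zero, integral_const_mul]
  field_simp

/-- Integration by parts against `φ`; the dilation `y ↦ x + t y` produces the factor `t`. -/
lemma integral_dilate_by_parts {v φ : E → ℝ} (hv : ContDiff ℝ 1 v) (hφ : ContDiff ℝ 1 φ)
    (hc : HasCompactSupport φ) (x e : E) (t : ℝ) :
    ∫ y, v (x + t • y) * fderiv ℝ φ y e ∂μ = -(t * ∫ y, fderiv ℝ v (x + t • y) e * φ y ∂μ) := by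
  have hv' : Continuous (fderiv ℝ v) := hv.continuous_fderiv (by simp)
  have hφ' : Continuous (fderiv ℝ φ) := hφ.continuous_fderiv (by simp)
  have hvc : Continuous v := hv.continuous
  have hd : ∀ y, HasFDerivAt (fun y ↦ v (x + t • y)) (t • fderiv ℝ v (x + t • y)) y := by
    intro y
    have h1 : HasFDerivAt (fun y : E ↦ x + t • y) (t • ContinuousLinearMap.id ℝ E) y :=
      ((hasFDerivAt_id y).const_smul t).const_add x
    refine ((hv.differentiable (by simp) _).hasFDerivAt.comp y h1).congr_fderiv ?_
    ext; simp
  rw [integral_mul_fderiv_eq_neg_fderiv_mul_of_integrable, ← integral_const_mul]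
  · simp only [(hd _).fderiv, smul_apply, smul_eq_mul, mul_assoc]
  · simp only [(hd _).fderiv]
    exact integrable_mul_of_hasCompactSupport μ (f := fun y ↦ (t • fderiv ℝ v (x + t • y)) e)
      (by fun_prop) hφ.continuous hc
  · exact integrable_mul_of_hasCompactSupport μ (f := fun y ↦ v (x + t • y)) (by fun_prop)
      (by fun_prop) (hc.fderiv_apply (𝕜 := ℝ) e)
  · exact integrable_mul_of_hasCompactSupport μ (f := fun y ↦ v (x + t • y)) (by fun_prop)
      hφ.continuous hc
  · exact fun y _ ↦ (hd y).differentiableAt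
  · exact fun y _ ↦ hφ.differentiable (by simp) y

/-! ### Averages of `u` and of its derivatives -/

/-- The divergence theorem for `∇ u`, the weight `quadBump 3 y • y` being `-∇ (quadBump 4) / 8`. -/
lemma integral_fderiv_eq_laplacian {u : E → ℝ} (hu : ContDiff ℝ 2 u) (x : E) (t : ℝ) :
    ∫ y, fderiv ℝ u (x + t • y) y * quadBump 3 y ∂μ =
      t * ∫ y, Laplacian.laplacian u (x + t • y) * (quadBump 4 y / 8) ∂μ := by
  set b := stdOrthonormalBasis ℝ E
  have hu' : Continuous (fderiv ℝ u) := hu.continuous_fderiv (by simp)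
  have hu'' : Continuous (fderiv ℝ (fderiv ℝ u)) :=
    (hu.fderiv_right (m := 1) (by norm_num)).continuous_fderiv (by simp)
  have h3 := continuous_quadBump (E := E) 3
  have h4 := continuous_quadBump (E := E) 4
  have hI : ∀ i, ∫ y, fderiv ℝ u (x + t • y) (b i) * (inner ℝ y (b i) * quadBump 3 y) ∂μ =
      t * ∫ y, fderiv ℝ (fderiv ℝ u) (x + t • y) (b i) (b i) * (quadBump 4 y / 8) ∂μ := by
    intro i
    have h := integral_dilate_by_parts μ (contDiff_fderiv_apply hu (b i)) (contDiff_quadBump 2)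
      (hasCompactSupport_quadBump (by simp)) x (b i) t
    simp only [fderiv_quadBump, fderiv_fderiv_apply hu] at h
    have e1 : ∀ y, fderiv ℝ u (x + t • y) (b i) * (inner ℝ y (b i) * quadBump 3 y) =
      (-1 / 8) * (fderiv ℝ u (x + t • y) (b i) *
        (-2 * ((2 : ℕ) + 2) * quadBump (2 + 1) y * inner ℝ y (b i))) := by
      intro y; push_cast; ring
    simp only [e1, integral_const_mul, h, ← mul_div_assoc, integral_div]
    ring
  have hsum : ∀ y, fderiv ℝ u (x + t • y) y =
      ∑ i, fderiv ℝ u (x + t • y) (b i) * inner ℝ y (b i) := fun y ↦ map_eq_sum_basis _ y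
  simp only [hsum, laplacian_eq_sum_fderiv, Finset.sum_mul]
  rw [integral_finsetSum, integral_finsetSum, Finset.mul_sum]
  · refine Finset.sum_congr rfl fun i _ ↦ ?_
    rw [← hI i]
    simp only [mul_assoc, b]
  · intro i _
    exact integrable_mul_of_hasCompactSupport μ
      (f := fun y ↦ fderiv ℝ (fderiv ℝ u) (x + t • y) (b i) (b i)) (by fun_prop) (by fun_prop)
      ((hasCompactSupport_quadBump (k := 4) (by simp)).mul_right)
  · intro i _
    exact integrable_mul_of_hasCompactSupport μ
      (f := fun y ↦ fderiv ℝ u (x + t • y) (b i) * inner ℝ y (b i)) (by fun_prop) h3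
      (hasCompactSupport_quadBump (by simp))

/-- Integrating by parts twice moves `∂ₑ` off `∂ₑ ∂ᵢ u` and puts `∂ᵢ` back in its place: the
vector field `quadBump 3 y • y` is a gradient, so its Jacobian is symmetric. -/
lemma integral_fderiv_fderiv_eq_laplacian {u : E → ℝ} (hu : ContDiff ℝ 2 u) (x e : E) {t : ℝ}
    (ht : t ≠ 0) :
    ∫ y, fderiv ℝ (fun z ↦ fderiv ℝ u z e) (x + t • y) y * quadBump 3 y ∂μ =
      ∫ y, Laplacian.laplacian u (x + t • y) * (inner ℝ y e * quadBump 3 y) ∂μ := by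
  set b := stdOrthonormalBasis ℝ E
  have hu'' : Continuous (fderiv ℝ (fderiv ℝ u)) :=
    (hu.fderiv_right (m := 1) (by norm_num)).continuous_fderiv (by simp)
  have h3 := continuous_quadBump (E := E) 3
  have hw : ∀ a : E, ContDiff ℝ 1 (fun y : E ↦ inner ℝ y a * quadBump 3 y) := fun a ↦
    (contDiff_id.inner ℝ contDiff_const).mul (contDiff_quadBump 1)
  have hwc : ∀ a : E, HasCompactSupport (fun y : E ↦ inner ℝ y a * quadBump 3 y) := fun a ↦
    (hasCompactSupport_quadBump (k := 3) (by simp)).mul_left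
  have hwd : ∀ a c y : E, fderiv ℝ (fun y : E ↦ inner ℝ y a * quadBump 3 y) y c =
      inner ℝ c a * quadBump 3 y - 6 * quadBump 2 y * inner ℝ y a * inner ℝ y c := by
    intro a c y
    have h1 : HasFDerivAt (fun y : E ↦ inner ℝ y a) (innerSL ℝ a) y := by
      simpa [real_inner_comm] using (innerSL ℝ a).hasFDerivAt (x := y)
    have h2 : HasFDerivAt (fun y : E ↦ inner ℝ y a * quadBump 3 y) _ y :=
      h1.mul (hasFDerivAt_quadBump 1 y)
    rw [h2.fderiv]
    simp [real_inner_comm]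
    ring
  have hI : ∀ i, ∫ y, fderiv ℝ (fderiv ℝ u) (x + t • y) e (b i) *
        (inner ℝ y (b i) * quadBump 3 y) ∂μ =
      ∫ y, fderiv ℝ (fderiv ℝ u) (x + t • y) (b i) (b i) * (inner ℝ y e * quadBump 3 y) ∂μ := by
    intro i
    have h1 := integral_dilate_by_parts μ (contDiff_fderiv_apply hu (b i)) (hw (b i)) (hwc (b i))
      x e t
    have h2 := integral_dilate_by_parts μ (contDiff_fderiv_apply hu (b i)) (hw e) (hwc e)
      x (b i) t
    simp only [hwd, fderiv_fderiv_apply hu] at h1 h2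
    refine mul_left_cancel₀ ht (neg_injective ?_)
    rw [← h1, ← h2]
    refine integral_congr_ae (Filter.Eventually.of_forall fun y ↦ ?_)
    simp only [real_inner_comm]
    ring
  have hsum : ∀ y, fderiv ℝ (fun z ↦ fderiv ℝ u z e) (x + t • y) y =
      ∑ i, fderiv ℝ (fderiv ℝ u) (x + t • y) e (b i) * inner ℝ y (b i) := fun y ↦ by
    rw [fderiv_fderiv_apply hu, fderiv_fderiv_comm hu]
    exact map_eq_sum_basis _ y
  simp only [hsum, laplacian_eq_sum_fderiv, Finset.sum_mul]
  rw [integral_finsetSum, integral_finsetSum]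
  · refine Finset.sum_congr rfl fun i _ ↦ ?_
    rw [← hI i]
    simp only [mul_assoc, b]
  · intro i _
    exact integrable_mul_of_hasCompactSupport μ
      (f := fun y ↦ fderiv ℝ (fderiv ℝ u) (x + t • y) (b i) (b i)) (by fun_prop) (by fun_prop)
      (hwc e)
  · intro i _
    exact integrable_mul_of_hasCompactSupport μ
      (f := fun y ↦ fderiv ℝ (fderiv ℝ u) (x + t • y) e (b i) * inner ℝ y (b i)) (by fun_prop) h3
      (hasCompactSupport_quadBump (by simp))

/-- A weighted form of the mean value property of harmonic functions. -/
lemma exists_average_sub_eq_laplacian {u : E → ℝ} (hu : ContDiff ℝ 2 u) (x : E) {T : ℝ}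
    (hT : 0 < T) :
    ∃ c ∈ Ioo 0 T, ∫ y, u (x + T • y) * quadBump 3 y ∂μ - u x * ∫ y, quadBump 3 y ∂μ =
      T * (c * ∫ y, Laplacian.laplacian u (x + c • y) * (quadBump 4 y / 8) ∂μ) := by
  obtain ⟨c, hc, h⟩ := exists_average_sub_eq μ (hu.of_le (by norm_num)) (continuous_quadBump 3)
    (hasCompactSupport_quadBump (by simp)) x hT
  exact ⟨c, hc, by rw [h, integral_fderiv_eq_laplacian μ hu]⟩

/-! ### Growth and gradient bounds -/

lemma mul_integral_le_average {u : E → ℝ} (hu : ContDiff ℝ 2 u)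
    (h0 : ∀ x, 0 ≤ Laplacian.laplacian u x) (x : E) {T : ℝ} (hT : 0 < T) :
    u x * ∫ y, quadBump 3 y ∂μ ≤ ∫ y, u (x + T • y) * quadBump 3 y ∂μ := by
  obtain ⟨c, hc, h⟩ := exists_average_sub_eq_laplacian μ hu x hT
  have : 0 ≤ T * (c * ∫ y, Laplacian.laplacian u (x + c • y) * (quadBump 4 y / 8) ∂μ) :=
    mul_nonneg hT.le (mul_nonneg hc.1.le (integral_nonneg fun y ↦
      mul_nonneg (h0 _) (div_nonneg (quadBump_nonneg 4 y) (by norm_num))))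
  linarith

lemma average_le_of_laplacian_le_one {u : E → ℝ} (hu : ContDiff ℝ 2 u)
    (h1 : ∀ x, Laplacian.laplacian u x ≤ 1) (x : E) {T : ℝ} (hT : 0 < T) :
    ∫ y, u (x + T • y) * quadBump 3 y ∂μ ≤
      u x * ∫ y, quadBump 3 y ∂μ + T ^ 2 * ∫ y, quadBump 4 y / 8 ∂μ := by
  obtain ⟨c, hc, h⟩ := exists_average_sub_eq_laplacian μ hu x hT
  have hc4 : HasCompactSupport (fun y : E ↦ quadBump 4 y / 8) :=
    (hasCompactSupport_quadBump (k := 4) (by simp)).mul_right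
  have h4 := continuous_quadBump (E := E) 4
  have hL := continuous_laplacian hu
  have hq : ∀ y : E, 0 ≤ quadBump 4 y / 8 := fun y ↦ div_nonneg (quadBump_nonneg 4 y) (by norm_num)
  have hle : ∫ y, Laplacian.laplacian u (x + c • y) * (quadBump 4 y / 8) ∂μ ≤
      ∫ y, quadBump 4 y / 8 ∂μ := by
    refine integral_mono (integrable_mul_of_hasCompactSupport μ
      (f := fun y ↦ Laplacian.laplacian u (x + c • y)) (by fun_prop) (by fun_prop) hc4)
      (Continuous.integrable_of_hasCompactSupport (by fun_prop) hc4) fun y ↦ ?_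
    exact mul_le_of_le_one_left (hq y) (h1 _)
  have : T * (c * ∫ y, Laplacian.laplacian u (x + c • y) * (quadBump 4 y / 8) ∂μ) ≤
      T * (T * ∫ y, quadBump 4 y / 8 ∂μ) := by
    refine mul_le_mul_of_nonneg_left ?_ hT.le
    exact (mul_le_mul_of_nonneg_left hle hc.1.le).trans
      (mul_le_mul_of_nonneg_right hc.2.le (integral_nonneg hq))
  linarith

/-- Averages of a nonnegative function over `B(x, T) ⊆ B(0, 2T)` are controlled by its average over
`B(0, 4T)`, on the inner half of which the weight is bounded below. -/
lemma integral_quadBump_le {u : E → ℝ} (hu : Continuous u) (h0 : ∀ x, 0 ≤ u x) {k : ℕ}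
    (hk : k ≠ 0) {x : E} {T : ℝ} (hT : 0 < T) (hx : ‖x‖ ≤ T) :
    ∫ y, u (x + T • y) * quadBump k y ∂μ ≤
      4 ^ (Module.finrank ℝ E + 1) * ∫ y, u ((4 * T) • y) * quadBump 3 y ∂μ := by
  have h3 := continuous_quadBump (E := E) 3
  have hkc := continuous_quadBump (E := E) k
  have hR : 4 * T ≠ 0 := by positivity
  set g : E → ℝ := fun z ↦ u z * quadBump 3 ((4 * T)⁻¹ • z) with hg
  have hcg : HasCompactSupport g :=
    ((hasCompactSupport_quadBump (k := 3) (by simp)).comp_smul (inv_ne_zero hR)).mul_left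
  have hgc : Continuous g := by fun_prop
  have hshift : ∫ y, g (x + T • y) ∂μ = (T ^ Module.finrank ℝ E)⁻¹ * ∫ z, g z ∂μ := by
    rw [Measure.integral_comp_smul μ (fun z ↦ g (x + z)), integral_add_left_eq_self, smul_eq_mul,
      abs_of_pos (by positivity)]
  have hdil : ∫ y, u ((4 * T) • y) * quadBump 3 y ∂μ =
      ((4 * T) ^ Module.finrank ℝ E)⁻¹ * ∫ z, g z ∂μ := by
    have h := Measure.integral_comp_smul μ g (4 * T)
    rw [abs_of_pos (by positivity), smul_eq_mul] at h
    rw [← h]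
    simp only [hg, smul_smul, inv_mul_cancel₀ hR, one_smul]
  have hpt : ∀ y, u (x + T • y) * quadBump k y ≤ 4 * g (x + T • y) := by
    intro y
    rcases le_total 1 ‖y‖ with hy | hy
    · rw [quadBump_eq_zero hk hy, mul_zero]
      exact mul_nonneg (by norm_num) (mul_nonneg (h0 _) (quadBump_nonneg _ _))
    · have hz : ‖(4 * T)⁻¹ • (x + T • y)‖ ≤ 1 / 2 := by
        rw [norm_smul, norm_inv, Real.norm_of_nonneg (by positivity),
          inv_mul_le_iff₀ (by positivity)]
        refine (norm_add_le _ _).trans ?_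
        rw [norm_smul, Real.norm_of_nonneg hT.le]
        nlinarith
      have h4 : (1 / 4 : ℝ) ≤ quadBump 3 ((4 * T)⁻¹ • (x + T • y)) := by
        have : (3 / 4 : ℝ) ≤ max 0 (1 - ‖(4 * T)⁻¹ • (x + T • y)‖ ^ 2) :=
          le_max_of_le_right (by nlinarith [norm_nonneg ((4 * T)⁻¹ • (x + T • y))])
        calc (1 / 4 : ℝ) ≤ (3 / 4) ^ 3 := by norm_num
          _ ≤ _ := pow_le_pow_left₀ (by norm_num) this 3
      have hk1 := quadBump_le_one k y
      calc u (x + T • y) * quadBump k y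
          ≤ u (x + T • y) * (4 * quadBump 3 ((4 * T)⁻¹ • (x + T • y))) :=
            mul_le_mul_of_nonneg_left (by linarith) (h0 _)
        _ = 4 * g (x + T • y) := by rw [hg]; ring
  have hcg' : HasCompactSupport fun y ↦ g (x + T • y) :=
    hcg.comp_homeomorph ((Homeomorph.smulOfNeZero T hT.ne').trans (Homeomorph.addLeft x))
  calc ∫ y, u (x + T • y) * quadBump k y ∂μ ≤ ∫ y, 4 * g (x + T • y) ∂μ := by
        refine integral_mono (integrable_mul_of_hasCompactSupport μ
          (f := fun y ↦ u (x + T • y)) (by fun_prop) hkc (hasCompactSupport_quadBump hk)) ?_ hpt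
        exact (Continuous.integrable_of_hasCompactSupport (by fun_prop) hcg').const_mul 4
    _ = _ := by
        rw [integral_const_mul, hshift, hdil, mul_pow]
        field_simp
        ring

lemma integral_quadBump_le_of_laplacian_le_one {u : E → ℝ} (hu : ContDiff ℝ 2 u)
    (h0 : ∀ x, 0 ≤ u x) (h1 : ∀ x, Laplacian.laplacian u x ≤ 1) {k : ℕ}
    (hk : k ≠ 0) {x : E} {T : ℝ} (hT : 0 < T) (hx : ‖x‖ ≤ T) :
    ∫ y, u (x + T • y) * quadBump k y ∂μ ≤ 4 ^ (Module.finrank ℝ E + 1) *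
      (u 0 * ∫ y, quadBump 3 y ∂μ + 16 * T ^ 2 * ∫ y, quadBump 4 y / 8 ∂μ) := by
  refine (integral_quadBump_le μ hu.continuous h0 hk hT hx).trans ?_
  have := average_le_of_laplacian_le_one μ hu h1 0 (T := 4 * T) (by positivity)
  simp only [zero_add] at this
  refine mul_le_mul_of_nonneg_left (this.trans_eq (by ring)) (by positivity)

/-- Interior gradient estimate: `∂ₑ u x` is compared with its average over `B(x, T)`, and there the
derivative is moved onto the weight. -/
lemma abs_fderiv_mul_integral_le {u : E → ℝ} (hu : ContDiff ℝ 2 u) (hpos : ∀ x, 0 ≤ u x)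
    (h0 : ∀ x, 0 ≤ Laplacian.laplacian u x) (h1 : ∀ x, Laplacian.laplacian u x ≤ 1) (x e : E)
    {T : ℝ} (hT : 0 < T) :
    |fderiv ℝ u x e| * ∫ y, quadBump 3 y ∂μ ≤
      ‖e‖ * (6 / T * ∫ y, u (x + T • y) * quadBump 2 y ∂μ + T * ∫ y, quadBump 3 y ∂μ) := by
  have h2c := continuous_quadBump (E := E) 2
  have huc := hu.continuous
  have hI := (integral_quadBump_pos μ (E := E) (k := 3) (by simp))
  have hin : ∀ {k : ℕ}, k ≠ 0 → ∀ y : E, |inner ℝ y e * quadBump k y| ≤ ‖e‖ * quadBump k y := by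
    intro k hk y
    rcases le_total 1 ‖y‖ with hy | hy
    · simp [quadBump_eq_zero hk hy]
    · rw [abs_mul, abs_of_nonneg (quadBump_nonneg k y)]
      refine mul_le_mul_of_nonneg_right ((abs_real_inner_le_norm y e).trans ?_)
        (quadBump_nonneg k y)
      exact mul_le_of_le_one_left (norm_nonneg e) hy
  obtain ⟨c, hc, h⟩ := exists_average_sub_eq μ (contDiff_fderiv_apply hu e) (continuous_quadBump 3)
    (hasCompactSupport_quadBump (by simp)) x hT
  rw [integral_fderiv_fderiv_eq_laplacian μ hu x e hc.1.ne'] at h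
  have hrem : |∫ y, Laplacian.laplacian u (x + c • y) * (inner ℝ y e * quadBump 3 y) ∂μ| ≤
      ‖e‖ * ∫ y, quadBump 3 y ∂μ := by
    rw [← integral_const_mul, ← Real.norm_eq_abs]
    refine norm_integral_le_of_norm_le (((continuous_quadBump 3).integrable_of_hasCompactSupport
      (hasCompactSupport_quadBump (by simp))).const_mul _) (Filter.Eventually.of_forall fun y ↦ ?_)
    rw [norm_mul, Real.norm_of_nonneg (h0 _), Real.norm_eq_abs]
    exact (mul_le_of_le_one_left (abs_nonneg _) (h1 _)).trans (hin (by simp) y)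
  have hibp := integral_dilate_by_parts μ (hu.of_le (by norm_num)) (contDiff_quadBump 1)
    (hasCompactSupport_quadBump (by simp)) x e T
  have hmain : |∫ y, fderiv ℝ u (x + T • y) e * quadBump 3 y ∂μ| ≤
      ‖e‖ * (6 / T * ∫ y, u (x + T • y) * quadBump 2 y ∂μ) := by
    have h6 : |∫ y, u (x + T • y) * fderiv ℝ (quadBump (1 + 2)) y e ∂μ| ≤
        6 * ‖e‖ * ∫ y, u (x + T • y) * quadBump 2 y ∂μ := by
      rw [← integral_const_mul, ← Real.norm_eq_abs]
      refine norm_integral_le_of_norm_le ((integrable_mul_of_hasCompactSupport μ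
        (f := fun y ↦ u (x + T • y)) (by fun_prop) h2c
        (hasCompactSupport_quadBump (by simp))).const_mul _)
        (Filter.Eventually.of_forall fun y ↦ ?_)
      rw [fderiv_quadBump, norm_mul, Real.norm_of_nonneg (hpos _)]
      have h7 : ‖-2 * (((1 : ℕ) : ℝ) + 2) * quadBump (1 + 1) y * inner ℝ y e‖ ≤
          6 * (‖e‖ * quadBump 2 y) := by
        refine le_trans (le_of_eq ?_)
          (mul_le_mul_of_nonneg_left (hin (k := 2) (by simp) y) (by norm_num))
        rw [show -2 * (((1 : ℕ) : ℝ) + 2) * quadBump (1 + 1) y * inner ℝ y e =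
          -6 * (inner ℝ y e * quadBump 2 y) by push_cast; ring, norm_mul]
        norm_num
      refine (mul_le_mul_of_nonneg_left h7 (hpos _)).trans_eq (by ring)
    rw [hibp, abs_neg, abs_mul, abs_of_pos hT] at h6
    rw [show ‖e‖ * (6 / T * ∫ y, u (x + T • y) * quadBump 2 y ∂μ) =
      (6 * ‖e‖ * ∫ y, u (x + T • y) * quadBump 2 y ∂μ) / T by ring, le_div_iff₀ hT, mul_comm]
    exact h6
  rw [← abs_of_pos hI, ← abs_mul, abs_of_pos hI]
  -- Solve the mean value identity `h` for the value at `x`: average minus remainder.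
  rw [show fderiv ℝ u x e * ∫ y, quadBump 3 y ∂μ = ∫ y, fderiv ℝ u (x + T • y) e * quadBump 3 y ∂μ
    - T * ∫ y, Laplacian.laplacian u (x + c • y) * (inner ℝ y e * quadBump 3 y) ∂μ by linarith]
  refine (abs_sub _ _).trans ?_
  rw [abs_mul, abs_of_pos hT]
  have := mul_le_mul_of_nonneg_left hrem hT.le
  linarith

end

theorem mainTheorem5 (n : ℕ) :
    ∃ C : ℝ, 0 < C ∧
      ∀ (τ : ℝ) (u : EuclideanSpace ℝ (Fin n) → ℝ),
        τ ≤ 0 →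
        ContDiff ℝ 2 u →
        (∀ x, 1 ≤ u x) →
        (∀ x, Laplacian.laplacian u x = u x ^ τ) →
        ∀ x, u x ≤ C * (‖x‖ ^ 2 + u 0) ∧ ‖gradient u x‖ ≤ C * (‖x‖ + u 0) := by
  set I : ℝ := ∫ y : EuclideanSpace ℝ (Fin n), quadBump 3 y with hI
  set J : ℝ := ∫ y : EuclideanSpace ℝ (Fin n), quadBump 4 y / 8 with hJ
  set A : ℝ := 4 ^ (Module.finrank ℝ (EuclideanSpace ℝ (Fin n)) + 1) with hA
  have hIpos : 0 < I := integral_quadBump_pos volume (by simp)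
  have hJnn : 0 ≤ J := integral_nonneg fun y ↦ div_nonneg (quadBump_nonneg 4 y) (by norm_num)
  have hApos : 0 < A := by positivity
  refine ⟨6 * A * (I + 32 * J) / I + 1, by positivity, fun τ u hτ hu hu1 hΔ x ↦ ?_⟩
  have hu0 : ∀ x, 0 ≤ u x := fun x ↦ zero_le_one.trans (hu1 x)
  have h0 : ∀ x, 0 ≤ Laplacian.laplacian u x := fun x ↦ by
    rw [hΔ]; exact Real.rpow_nonneg (hu0 x) τ
  have h1 : ∀ x, Laplacian.laplacian u x ≤ 1 := fun x ↦ by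
    rw [hΔ]; exact Real.rpow_le_one_of_one_le_of_nonpos (hu1 x) hτ
  have hU := hu1 0
  have hx := norm_nonneg x
  -- The summand `1` keeps the radius positive at `x = 0`; it is absorbed by `u 0 ≥ 1` later.
  set T : ℝ := ‖x‖ + 1 with hTdef
  have hT : 0 < T := by positivity
  have hxT : ‖x‖ ≤ T := by linarith
  have hAI : 0 ≤ A * I := by positivity
  have hAJ : 0 ≤ A * J := by positivity
  constructor
  · have h := (mul_integral_le_average volume hu h0 x hT).trans
      (integral_quadBump_le_of_laplacian_le_one volume hu hu0 h1 (by simp) hT hxT)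
    rw [← hI, ← hJ, ← hA] at h
    have hT2 : T ^ 2 ≤ 2 * (‖x‖ ^ 2 + u 0) := by nlinarith [sq_nonneg (‖x‖ - 1)]
    have hS : u 0 ≤ ‖x‖ ^ 2 + u 0 := by nlinarith
    have h2 : u x * I ≤ 6 * A * (I + 32 * J) * (‖x‖ ^ 2 + u 0) := by
      have e1 := mul_le_mul_of_nonneg_left hT2 hAJ
      have e2 := mul_le_mul_of_nonneg_left hS hAI
      have e3 : 0 ≤ A * I * (‖x‖ ^ 2 + u 0) := by positivity
      have e4 : 0 ≤ A * J * (‖x‖ ^ 2 + u 0) := by positivity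
      linarith
    rw [← le_div_iff₀ hIpos] at h2
    refine h2.trans ?_
    rw [add_mul, one_mul, div_mul_eq_mul_div]
    linarith
  · have hS : 0 ≤ ‖x‖ + u 0 := by linarith
    have hnorm : ‖gradient u x‖ = ‖fderiv ℝ u x‖ := by
      unfold gradient; exact LinearIsometryEquiv.norm_map _ _
    rw [hnorm]
    refine ContinuousLinearMap.opNorm_le_bound _ (by positivity) fun e ↦ ?_
    have h := abs_fderiv_mul_integral_le volume hu hu0 h0 h1 x e hT
    have hB := integral_quadBump_le_of_laplacian_le_one volume hu hu0 h1 (k := 2) (by simp) hT hxT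
    rw [← hI, ← hJ, ← hA] at hB
    rw [← hI] at h
    have hTS : T ≤ ‖x‖ + u 0 := by linarith
    have huT : u 0 / T ≤ ‖x‖ + u 0 := (div_le_self (hu0 0) (by linarith)).trans (by linarith)
    have h2 : 6 / T * ∫ y, u (x + T • y) * quadBump 2 y ≤
        6 * A * (I + 16 * J) * (‖x‖ + u 0) := by
      refine (mul_le_mul_of_nonneg_left hB (by positivity)).trans ?_
      have e0 : 6 / T * (A * (u 0 * I + 16 * T ^ 2 * J)) =
          6 * (A * I * (u 0 / T) + 16 * (A * J * T)) := by field_simp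
      rw [e0]
      have e1 := mul_le_mul_of_nonneg_left hTS hAJ
      have e2 := mul_le_mul_of_nonneg_left huT hAI
      linarith
    have h3 : |fderiv ℝ u x e| * I ≤
        ((6 * A * (I + 32 * J) / I + 1) * (‖x‖ + u 0) * ‖e‖) * I := by
      refine h.trans ?_
      have e1 := mul_le_mul_of_nonneg_right hTS hIpos.le
      have e4 : 0 ≤ A * J * (‖x‖ + u 0) := by positivity
      calc _ ≤ ‖e‖ * ((6 * A * (I + 32 * J) + I) * (‖x‖ + u 0)) :=
            mul_le_mul_of_nonneg_left (by linarith) (norm_nonneg e)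
        _ = _ := by field_simp
    exact le_of_mul_le_mul_right h3 hIpos
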